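/- Let $n\ge 1$ be an integer, let $m>0$ be real, and let $\gamma>0$ if $n\ge 2m$, $\gamma\ge 1-\frac{n}{2m}$ if $n<2m$. Put $\alpha=\gamma+\frac{n}{2m}$ and let $q\in L_{\alpha}(\mathbb R^n)$ be complex-valued. Let $H_0=(-\Delta)^m$ be the operator in $L_2(\mathbb R^n)$ that the Fourier transform turns into multiplication by $|\xi|^{2m}$, on its maximal domain. Factorize $q=ab$ with $a=|q|^{1/2}$ and $b=(\operatorname{sign} q)\,|q|^{1/2}$, where $\operatorname{sign} q=q/|q|$ if $q\neq0$ and $\operatorname{sign} 0=0$, and let $A$, $B$ be the operators of multiplication by $a$, $b$ in $L_2(\mathbb R^n)$ with maximal domains. Let $H_{m,q}$ be the realization of $(-\Delta)^m+q$ in $L_2(\mathbb R^n)$ that extends $H_0+AB$ as follows: $u\in D(H_{m,q})$ and $H_{m,q}u=f$ if and only if $u\in D(B)$, $f\in L_2(\mathbb R^n)$ and $(H_0v,u)+(A^*v,Bu)=(v,f)$ for all $v\in D(H_0)\cap D(A^*)$. Then every eigenvalue $\lambda\in\mathbb C\setminus[0,\infty)$ of $H_{m,q}$ satisfies $$|\lambda|^{\gamma}\le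 C(n,m,\alpha,\theta)\int_{\mathbb R^n}|q(x)|^{\gamma+\frac{n}{2m}}\,dx ,\qquad \theta=\arg\lambda,$$ where $$C(n,m,\alpha,\theta)=\frac{(4\pi)^{-n/2}}{m\,\Gamma(n/2)}\int_0^\infty\frac{t^{\frac{n}{2m}-1}}{(t^2-2t\cos\theta+1)^{\alpha/2}}\,dt .$$ -/

import Mathlib

open MeasureTheory
open scoped FourierTransform InnerProductSpace

noncomputable section

namespace Polyharmonic

/-- The space `ℝⁿ` with its Euclidean norm. -/
abbrev Rn (n : ℕ) : Type := EuclideanSpace ℝ (Fin n)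

/-- The complex Hilbert space `L₂(ℝⁿ)` (Lebesgue measure). -/
abbrev L2 (n : ℕ) : Type := Lp ℂ 2 (volume : Measure (Rn n))

/-- The maximal domain `{u ∈ L₂ : f u ∈ L₂}` of the multiplication by `f` in `L₂(ℝⁿ)`. -/
def mulDomain {n : ℕ} (f : Rn n → ℂ) : Submodule ℂ (L2 n) where
  carrier := {u | MemLp (fun x => f x * u x) 2 volume}
  add_mem' := by
    intro u v hu hv
    refine (MemLp.add hu hv).ae_eq ?_
    filter_upwards [Lp.coeFn_add u v] with x hx
    simp only [hx, Pi.add_apply, mul_add]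
  zero_mem' := by
    refine (MemLp.zero (ε := ℂ)).ae_eq ?_
    filter_upwards [Lp.coeFn_zero ℂ 2 (volume : Measure (Rn n))] with x hx
    simp only [hx, Pi.zero_apply, mul_zero]
  smul_mem' := by
    intro c u hu
    refine (MemLp.const_smul hu c).ae_eq ?_
    filter_upwards [Lp.coeFn_smul c u] with x hx
    simp only [hx, Pi.smul_apply, smul_eq_mul, mul_left_comm]

theorem mem_mulDomain {n : ℕ} {f : Rn n → ℂ} {u : L2 n} :
    u ∈ mulDomain f ↔ MemLp (fun x => f x * u x) 2 volume := Iff.rfl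

/-- The operator of multiplication by `f` in `L₂(ℝⁿ)`, with its maximal domain. -/
def mulOp {n : ℕ} (f : Rn n → ℂ) : L2 n →ₗ.[ℂ] L2 n where
  domain := mulDomain f
  toFun :=
    { toFun := fun u => MemLp.toLp (fun x => f x * (u : L2 n) x) (mem_mulDomain.1 u.2)
      map_add' := by
        intro u v
        rw [← MemLp.toLp_add]
        refine MemLp.toLp_congr _ _ ?_
        filter_upwards [Lp.coeFn_add (u : L2 n) (v : L2 n)] with x hx
        rw [Submodule.coe_add, hx]
        simp only [Pi.add_apply, mul_add]
      map_smul' := by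
        intro c u
        rw [RingHom.id_apply, ← MemLp.toLp_const_smul]
        refine MemLp.toLp_congr _ _ ?_
        filter_upwards [Lp.coeFn_smul c (u : L2 n)] with x hx
        rw [Submodule.coe_smul, hx]
        simp only [Pi.smul_apply, smul_eq_mul, mul_left_comm] }

/-- The Fourier transform on `L₂(ℝⁿ)`, as a linear map. -/
def fourierL2 (n : ℕ) : L2 n →ₗ[ℂ] L2 n :=
  (Lp.fourierTransformₗᵢ (Rn n) ℂ).toLinearEquiv.toLinearMap

/-- The inverse Fourier transform on `L₂(ℝⁿ)`, as a linear map. -/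
def fourierInvL2 (n : ℕ) : L2 n →ₗ[ℂ] L2 n :=
  (Lp.fourierTransformₗᵢ (Rn n) ℂ).symm.toLinearEquiv.toLinearMap

/-- The Fourier symbol of `(-Δ)^m`. Mathlib's Fourier transform is
`û(ξ) = ∫ e^{-2πi⟨x,ξ⟩} u(x) dx`, so that `-Δ` has the symbol `(2π|ξ|)²`. -/
def symbol {n : ℕ} (m : ℝ) (ξ : Rn n) : ℂ := (((2 * Real.pi * ‖ξ‖) ^ (2 * m) : ℝ) : ℂ)

/-- The unperturbed operator `H₀ = (-Δ)^m` in `L₂(ℝⁿ)`, for real `m > 0`: the conjugate, under the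
Fourier transform, of the multiplication by the symbol, on its maximal domain. -/
def freeOp (n : ℕ) (m : ℝ) : L2 n →ₗ.[ℂ] L2 n where
  domain := (mulDomain (n := n) (symbol m)).comap (fourierL2 n)
  toFun :=
    { toFun := fun u =>
        fourierInvL2 n (mulOp (n := n) (symbol m) ⟨fourierL2 n (u : L2 n), u.2⟩)
      map_add' := by
        intro u v
        rw [← map_add, ← LinearPMap.map_add]
        congr 2
        exact Subtype.ext (map_add (fourierL2 n) _ _)
      map_smul' := by
        intro c u
        rw [RingHom.id_apply, ← map_smul, ← LinearPMap.map_smul]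
        congr 2
        exact Subtype.ext (map_smul (fourierL2 n) _ _) }

/-- The graph of the extension of `H₀ + A B`, where `H₀ = (-Δ)^m` and `A`, `B` are the operators of
multiplication by `a`, `b` with maximal domains. A pair `(u, f)` belongs to it when `u ∈ D(B)` and
`⟨H₀ v, u⟩ + ⟨A* v, B u⟩ = ⟨v, f⟩` for all `v ∈ D(H₀) ∩ D(A*)`, where `A*` is the multiplication by
the conjugate of `a`. If `A* (H₀ - z̄)⁻¹` is bounded, this says that
`u = (H₀ - z)⁻¹ (f - z u) - [(H₀ - z)⁻¹ A] B u`, with `[ ]` the bounded extension, for a regular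
point `z` of `H₀`; if moreover `1 + Q(z)` is invertible, where `Q(z) = [B (H₀ - z)⁻¹ A]`, it is the
graph of the closed operator with the resolvent
`(H₀ - z)⁻¹ - [(H₀ - z)⁻¹ A] (1 + Q(z))⁻¹ B (H₀ - z)⁻¹`. -/
def extGraph {n : ℕ} (m : ℝ) (a b : Rn n → ℂ) : Submodule ℂ (L2 n × L2 n) where
  carrier := {p | ∃ hu : p.1 ∈ mulDomain b,
    ∀ (v : L2 n) (hv : v ∈ (freeOp n m).domain)
      (hv' : v ∈ mulDomain (fun x => starRingEnd ℂ (a x))),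
      ⟪freeOp n m ⟨v, hv⟩, p.1⟫_ℂ +
        ⟪mulOp (fun x => starRingEnd ℂ (a x)) ⟨v, hv'⟩, mulOp b ⟨p.1, hu⟩⟫_ℂ = ⟪v, p.2⟫_ℂ}
  add_mem' := by
    rintro ⟨u, f⟩ ⟨u', f'⟩ ⟨hu, h⟩ ⟨hu', h'⟩
    refine ⟨Submodule.add_mem _ hu hu', fun v hv hv' => ?_⟩
    have e : mulOp b ⟨u + u', Submodule.add_mem _ hu hu'⟩ = mulOp b ⟨u, hu⟩ + mulOp b ⟨u', hu'⟩ :=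
      LinearPMap.map_add (mulOp b) ⟨u, hu⟩ ⟨u', hu'⟩
    have h1 := h v hv hv'
    have h2 := h' v hv hv'
    dsimp only [Prod.mk_add_mk] at h1 h2 ⊢
    rw [e, inner_add_right, inner_add_right, inner_add_right, ← h1, ← h2]
    ring
  zero_mem' := by
    refine ⟨Submodule.zero_mem _, fun v hv hv' => ?_⟩
    have e : mulOp b ⟨0, Submodule.zero_mem _⟩ = 0 := LinearPMap.map_zero (mulOp b)
    dsimp only [Prod.fst_zero, Prod.snd_zero]
    rw [e, inner_zero_right, inner_zero_right, inner_zero_right, add_zero]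
  smul_mem' := by
    rintro c ⟨u, f⟩ ⟨hu, h⟩
    refine ⟨Submodule.smul_mem _ c hu, fun v hv hv' => ?_⟩
    have e : mulOp b ⟨c • u, Submodule.smul_mem _ c hu⟩ = c • mulOp b ⟨u, hu⟩ :=
      LinearPMap.map_smul (mulOp b) c ⟨u, hu⟩
    have h1 := h v hv hv'
    dsimp only [Prod.smul_mk] at h1 ⊢
    rw [e, inner_smul_right, inner_smul_right, inner_smul_right, ← h1]
    ring

/-- The factor `a = |q|^{1/2}` of the potential. -/
def factorA {n : ℕ} (q : Rn n → ℂ) (x : Rn n) : ℂ := (Real.sqrt ‖q x‖ : ℂ)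

/-- The factor `b = (sign q) |q|^{1/2}` of the potential, where `sign q = q / |q|`, and
`sign q = 0` where `q = 0`; thus `q = a b`. -/
def factorB {n : ℕ} (q : Rn n → ℂ) (x : Rn n) : ℂ := q x / (‖q x‖ : ℂ) * (Real.sqrt ‖q x‖ : ℂ)

/-- The operator `H_{m,q} = (-Δ)^m + q` in `L₂(ℝⁿ)`: the extension of `H₀ + A B` for the
factorization `q = a b` with `a = |q|^{1/2}` and `b = (sign q) |q|^{1/2}`. -/
def polyOp {n : ℕ} (m : ℝ) (q : Rn n → ℂ) : L2 n →ₗ.[ℂ] L2 n :=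
  (extGraph m (factorA q) (factorB q)).toLinearPMap

/-- `lam` is an eigenvalue of the (unbounded) operator `T`. -/
def IsEigenvalue {E : Type*} [AddCommGroup E] [Module ℂ E] (T : E →ₗ.[ℂ] E) (lam : ℂ) : Prop :=
  ∃ u : T.domain, (u : E) ≠ 0 ∧ T u = lam • (u : E)

/-- The integral `I_m(n, α, θ) = ∫₀^∞ t^{n/2m - 1} (t² - 2 t cos θ + 1)^{-α/2} dt`. -/
def constI (n : ℕ) (m α θ : ℝ) : ℝ :=
  ∫ t in Set.Ioi (0 : ℝ), t ^ ((n : ℝ) / (2 * m) - 1) / (t ^ 2 - 2 * t * Real.cos θ + 1) ^ (α / 2)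

/-- The constant `C(n, m, α, θ) = (4π)^{-n/2} (m Γ(n/2))⁻¹ I_m(n, α, θ)`. -/
def constC (n : ℕ) (m α θ : ℝ) : ℝ :=
  (4 * Real.pi) ^ (-((n : ℝ) / 2)) * (m * Real.Gamma ((n : ℝ) / 2))⁻¹ * constI n m α θ

open scoped SchwartzMap in
/-- Schwartz functions belong to the domain of `(-Δ)^m`. -/
theorem schwartz_mem_freeOp_domain {n : ℕ} {m : ℝ} (hm : 0 < m) (φ : 𝓢(Rn n, ℂ)) :
    φ.toLp 2 volume ∈ (freeOp n m).domain := by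
  change MemLp (fun x => symbol m x * (𝓕 (φ.toLp 2 volume) : L2 n) x) 2 volume
  rw [SchwartzMap.toLp_fourier_eq]
  set ψ : 𝓢(Rn n, ℂ) := 𝓕 φ
  have hg := Function.hasTemperateGrowth_one_add_norm_sq_rpow (Rn n) m
  have hb := (SchwartzMap.smulLeftCLM ℂ (fun x : Rn n => (1 + ‖x‖ ^ 2) ^ m) ψ).memLp 2 volume
  have hs : Measurable (fun x : Rn n => symbol m x) := by
    unfold symbol
    fun_prop
  refine MemLp.of_le_mul (c := (2 * Real.pi) ^ (2 * m)) hb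
    (hs.aestronglyMeasurable.mul (Lp.aestronglyMeasurable _)) ?_
  filter_upwards [ψ.coeFn_toLp 2 volume] with x hx
  have h1 : ‖x‖ ^ (2 * m) ≤ (1 + ‖x‖ ^ 2) ^ m := by
    rw [Real.rpow_mul (norm_nonneg x), Real.rpow_two]
    exact Real.rpow_le_rpow (by positivity) (by linarith) hm.le
  have h2 : ‖symbol m x‖ = (2 * Real.pi) ^ (2 * m) * ‖x‖ ^ (2 * m) := by
    rw [symbol, Complex.norm_real, Real.norm_of_nonneg (by positivity),
      Real.mul_rpow (by positivity) (norm_nonneg x)]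
  have h3 : (0 : ℝ) ≤ (1 + ‖x‖ ^ 2) ^ m := by positivity
  rw [SchwartzMap.smulLeftCLM_apply_apply hg, hx, norm_mul, norm_smul, h2,
    Real.norm_of_nonneg h3, mul_assoc]
  gcongr

open scoped SchwartzMap in
/-- If `q ∈ L_p` with `p ≥ 1`, Schwartz functions belong to the domain of the multiplication by the
conjugate of `|q|^{1/2}`. -/
theorem schwartz_mem_factorA_domain {n : ℕ} {q : Rn n → ℂ} {p : ENNReal} (hp : 1 ≤ p)
    (hq : MemLp q p volume) (φ : 𝓢(Rn n, ℂ)) :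
    φ.toLp 2 volume ∈ mulDomain (fun x => starRingEnd ℂ (factorA q x)) := by
  change MemLp (fun x => starRingEnd ℂ (factorA q x) * (φ.toLp 2 volume : L2 n) x) 2 volume
  have hmeas : AEStronglyMeasurable (fun x => starRingEnd ℂ (factorA q x)) volume := by
    have h : AEMeasurable (fun x => (Real.sqrt ‖q x‖ : ℂ)) volume :=
      Complex.measurable_ofReal.comp_aemeasurable
        (Real.continuous_sqrt.measurable.comp_aemeasurable hq.1.norm.aemeasurable)
    exact (Complex.continuous_conj.measurable.comp_aemeasurable h).aestronglyMeasurable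
  refine (memLp_two_iff_integrable_sq_norm (hmeas.mul (Lp.aestronglyMeasurable _))).2 ?_
  have : ENNReal.HolderConjugate p p.conjExponent := .conjExponent hp
  have h1 : MemLp (fun x => ‖φ x‖ * ‖φ x‖) p.conjExponent volume :=
    MemLp.mul' (p := ⊤) (q := p.conjExponent) (φ.memLp _ volume).norm (φ.memLp _ volume).norm
  have h2 : Integrable (fun x => ‖q x‖ * (‖φ x‖ * ‖φ x‖)) volume :=
    MemLp.integrable_mul hq.norm h1
  refine h2.congr ?_
  filter_upwards [φ.coeFn_toLp 2 volume] with x hx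
  rw [Pi.mul_apply, hx, norm_mul, mul_pow, RCLike.norm_conj, factorA, Complex.norm_real,
    Real.norm_of_nonneg (Real.sqrt_nonneg _), Real.sq_sqrt (norm_nonneg _), sq]

/-- If `q ∈ L_p` for some `p ≥ 1`, the graph that defines `H_{m,q}` is single-valued, hence it is
the graph of `H_{m,q}`. -/
theorem polyOp_graph {n : ℕ} {m : ℝ} (hm : 0 < m) {q : Rn n → ℂ} {p : ENNReal} (hp : 1 ≤ p)
    (hq : MemLp q p volume) :
    (polyOp m q).graph = extGraph m (factorA q) (factorB q) := by
  refine Submodule.toLinearPMap_graph_eq _ ?_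
  rintro ⟨u, f⟩ ⟨hu, h⟩ hu0
  dsimp only at hu0 h ⊢
  subst hu0
  have e : mulOp (factorB q) ⟨0, hu⟩ = 0 := LinearPMap.map_zero (mulOp (factorB q))
  refine (SchwartzMap.denseRange_toLpCLM (E := Rn n) (F := ℂ) (p := 2)
    (μ := volume) ENNReal.ofNat_ne_top).eq_zero_of_inner_right ℂ ?_
  intro φ
  have := h _ (schwartz_mem_freeOp_domain hm φ) (schwartz_mem_factorA_domain hp hq φ)
  rw [e, inner_zero_right, inner_zero_right, add_zero] at this
  exact this.symm

end Polyharmonic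

end

/-! This is the Birman–Schwinger argument, carried out with operator norms only. Let `R =
(|2πξ|^{2m} - λ̄)⁻¹` and `|G|² = |R|`. Testing the identity that defines the eigenvector `u` with `v
= (H₀ - λ̄)⁻¹ w` cancels the terms with `λ` and leaves `⟨w, u⟩ = -⟨A* v, B u⟩`. If `G 𝓕 a` and `G 𝓕
b̄` are bounded by `K`, this gives `|⟨w, u⟩| ≤ K ‖G 𝓕 w‖ ‖B u‖`. Formally `w = b̄ b u` then yields
`‖B u‖ ≤ K² ‖B u‖`; since `B u ≠ 0`, `1 ≤ K²` (`one_le_of_mem_extGraph`). Truncations of `a` and `b`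
make this rigorous.

The constant `K` comes from a Kato–Seiler–Simon bound (`norm_bddMul_fourier_le`): for `0 < s ≤ 1`
the operator `h^s 𝓕 f^s` has norm at most `(‖f‖₂ ‖h‖₂)^s`. It is interpolated between `Re z = 0`,
where Plancherel gives `1`, and `Re z = 1`, where Cauchy–Schwarz and the `L₁`-`L_∞` bound of `𝓕`
give `‖f‖₂ ‖h‖₂`. Taking `s = 1/α`, `f = |q|^{α/2}`, `h = |R|^{α/2}` makes `f^s = |a| = |b|` and
`h^s = |R|^{1/2}`, so that `K² = (∫|q|^α ∫|R|^α)^{1/α}`.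

Finally, polar coordinates and scaling by `|λ|` evaluate `∫|R|^α = |λ|^{-γ} C`
(`integral_norm_symbol_sub_rpow`). -/

namespace Polyharmonic

open scoped ComplexConjugate ContDiff
open Filter Topology

/-! ### The Fourier transform on `L₁ ∩ L₂`. -/

/-- The Fourier transform of an integrable function in `L₂` is given by the Fourier integral. -/
theorem fourier_ae_eq_of_integrable {n : ℕ} (f : L2 n) (hf : Integrable f volume) :
    (𝓕 f : L2 n) =ᵐ[volume] 𝓕 (f : Rn n → ℂ) := by
  have hcont : Continuous (𝓕 (f : Rn n → ℂ)) :=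
    VectorFourier.fourierIntegral_continuous Real.continuous_fourierChar
      (by exact continuous_inner) hf
  -- The two transforms are compared against test functions: on the `L₂` side the transform moves to
  -- the test function by its agreement with the distributional one, on the `L₁` side by Fubini.
  refine ae_eq_of_integral_contDiff_smul_eq
    ((Lp.memLp (𝓕 f : L2 n)).locallyIntegrable (by norm_num)) hcont.locallyIntegrable ?_
  intro g hg hgc
  have hg₁ : HasCompactSupport (Complex.ofRealCLM ∘ g) := hgc.comp_left rfl
  have hg₂ : ContDiff ℝ ∞ (Complex.ofRealCLM ∘ g) := by fun_prop
  set ψ := hg₁.toSchwartzMap hg₂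
  have hψ : ∀ x, ψ x = (g x : ℂ) := fun x => rfl
  have h1 := congrArg (fun T => T ψ) (Lp.fourier_toTemperedDistribution_eq f)
  simp only [TemperedDistribution.fourier_apply, Lp.toTemperedDistribution_apply] at h1
  have h2 : ∫ x, 𝓕 (ψ : Rn n → ℂ) x • f x = ∫ x, ψ x • 𝓕 (f : Rn n → ℂ) x := by
    have := VectorFourier.integral_fourierIntegral_smul_eq_flip (L := innerₗ (Rn n))
      (μ := (volume : Measure (Rn n))) (ν := (volume : Measure (Rn n)))
      (e := Real.fourierChar) (f := ψ) (g := f)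
      Real.continuous_fourierChar continuous_inner ψ.integrable hf
    rw [flip_innerₗ] at this
    exact this
  have h3 : ∀ (h : Rn n → ℂ), ∫ x, g x • h x = ∫ x, ψ x • h x := by
    intro h
    refine integral_congr_ae (.of_forall fun x => ?_)
    simp [hψ]
  rw [h3, h3, ← h1, ← h2]
  rfl

/-- The `L₁`-`L_∞` bound of the Fourier transform, in bilinear form. -/
theorem norm_inner_fourier_le_integral_mul {n : ℕ} (f g : L2 n) (hf : Integrable f volume)
    (hg : Integrable g volume) :
    ‖⟪g, 𝓕 f⟫_ℂ‖ ≤ (∫ x, ‖f x‖) * ∫ x, ‖g x‖ := by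
  rw [L2.inner_def, ← integral_const_mul]
  refine norm_integral_le_of_norm_le (hg.norm.const_mul _) ?_
  filter_upwards [fourier_ae_eq_of_integrable f hf] with x hx
  rw [hx, RCLike.inner_apply, norm_mul, RCLike.norm_conj]
  gcongr
  exact VectorFourier.norm_fourierIntegral_le_integral_norm _ _ _ _ _

/-! ### Complex interpolation for simple weights. -/

/-- The three lines theorem for a finite sum of exponentials. -/
theorem norm_sum_cpow_le {ι : Type*} (I : Finset ι) (c : ι → ℂ) (p : ι → ℝ)
    (hp : ∀ i ∈ I, 0 < p i) {A B s : ℝ}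
    (hA : ∀ z : ℂ, z.re = 0 → ‖∑ i ∈ I, c i * (p i : ℂ) ^ z‖ ≤ A)
    (hB : ∀ z : ℂ, z.re = 1 → ‖∑ i ∈ I, c i * (p i : ℂ) ^ z‖ ≤ B)
    (hs : 0 ≤ s) (hs' : s ≤ 1) :
    ‖∑ i ∈ I, c i * (p i : ℂ) ^ (s : ℂ)‖ ≤ A ^ (1 - s) * B ^ s := by
  have hd : Differentiable ℂ (fun z : ℂ => ∑ i ∈ I, c i * (p i : ℂ) ^ z) := by
    refine Differentiable.fun_sum fun i hi => ?_
    have h0 : (p i : ℂ) ≠ 0 := by exact_mod_cast (hp i hi).ne'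
    exact (differentiable_const _).mul
      (differentiable_id.const_cpow (Or.inl h0))
  have hz : (s : ℂ) ∈ Complex.HadamardThreeLines.verticalClosedStrip 0 1 := by
    simp [Complex.HadamardThreeLines.verticalClosedStrip, hs, hs']
  have key := Complex.HadamardThreeLines.norm_le_interp_of_mem_verticalClosedStrip₀₁'
    (fun z : ℂ => ∑ i ∈ I, c i * (p i : ℂ) ^ z) (z := (s : ℂ)) (a := A) (b := B) hz
    hd.diffContOnCl ?_ (fun z hz => hA z hz) (fun z hz => hB z hz)
  · simpa using key
  · refine ⟨∑ i ∈ I, ‖c i‖ * max 1 (p i), ?_⟩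
    rintro _ ⟨z, hz, rfl⟩
    simp only [Complex.HadamardThreeLines.verticalClosedStrip, Set.mem_preimage, Set.mem_Icc] at hz
    refine (norm_sum_le _ _).trans (Finset.sum_le_sum fun i hi => ?_)
    rw [norm_mul, Complex.norm_cpow_eq_rpow_re_of_pos (hp i hi)]
    gcongr
    rcases le_total 1 (p i) with h | h
    · exact (Real.rpow_le_rpow_of_exponent_le h hz.2).trans (by simp)
    · exact (Real.rpow_le_one (hp i hi).le h hz.1).trans (le_max_left _ _)

/-- The product of an element of `L₂` with a simple function is in `L₂`. -/
theorem memLp_simpleFunc_mul {n : ℕ} (h : SimpleFunc (Rn n) ℂ) (φ : L2 n) :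
    MemLp (fun x => h x * φ x) 2 volume :=
  MemLp.mul' (p := ⊤) (q := 2) (Lp.memLp φ) (h.memLp_top volume)

/-- The product of an element of `L₂` with a simple function. -/
noncomputable def simpleMul {n : ℕ} (h : SimpleFunc (Rn n) ℂ) (φ : L2 n) : L2 n :=
  (memLp_simpleFunc_mul h φ).toLp _

theorem coeFn_simpleMul {n : ℕ} (h : SimpleFunc (Rn n) ℂ) (φ : L2 n) :
    simpleMul h φ =ᵐ[volume] fun x => h x * φ x :=
  MemLp.coeFn_toLp _

theorem norm_simpleMul_le {n : ℕ} (h : SimpleFunc (Rn n) ℂ) (φ : L2 n) (hh : ∀ x, ‖h x‖ ≤ 1) :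
    ‖simpleMul h φ‖ ≤ ‖φ‖ := by
  refine Lp.norm_le_norm_of_ae_le ?_
  filter_upwards [coeFn_simpleMul h φ] with x hx
  rw [hx, norm_mul]
  exact mul_le_of_le_one_left (norm_nonneg _) (hh x)

/-- The Cauchy-Schwarz inequality. -/
theorem integral_norm_smul_le {X : Type*} [MeasurableSpace X] {μ : Measure X} {f : X → ℝ}
    {φ : X → ℂ} (hf : MemLp f 2 μ) (hφ : MemLp φ 2 μ) :
    Integrable (fun x => f x • φ x) μ ∧
      ∫ x, ‖f x • φ x‖ ∂μ ≤ (eLpNorm f 2 μ).toReal * (eLpNorm φ 2 μ).toReal := by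
  have h1 : MemLp (f • φ) 1 μ := hφ.smul hf
  have h2 : eLpNorm (f • φ) 1 μ ≤ eLpNorm f 2 μ * eLpNorm φ 2 μ :=
    eLpNorm_smul_le_mul_eLpNorm hφ.1 hf.1
  have h3 := ENNReal.toReal_mono (ENNReal.mul_ne_top hf.2.ne hφ.2.ne) h2
  rw [eLpNorm_one_eq_lintegral_enorm, ← integral_norm_eq_lintegral_enorm h1.1,
    ENNReal.toReal_mul] at h3
  exact ⟨memLp_one_iff_integrable.1 h1, h3⟩

/-- Splitting along the level sets of `f` isolates the dependence on `k`; with `k = posPow z` it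
turns the interpolated form into a finite sum of exponentials in `z`. -/
theorem simpleMul_map {n : ℕ} (f : SimpleFunc (Rn n) ℝ) (k : ℝ → ℂ) (φ : L2 n) :
    simpleMul (f.map k) φ =
      ∑ y ∈ f.range, k y • simpleMul (f.map fun t => if t = y then 1 else 0) φ := by
  refine Lp.ext ?_
  have h : ∀ y ∈ f.range,
      (k y • simpleMul (f.map fun t => if t = y then 1 else 0) φ : L2 n) =ᵐ[volume]
        fun x => k y * ((if f x = y then 1 else 0) * φ x) := by
    intro y _
    filter_upwards [Lp.coeFn_smul (k y) (simpleMul (f.map fun t => if t = y then 1 else 0) φ),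
      coeFn_simpleMul (f.map fun t => if t = y then 1 else 0) φ] with x h1 h2
    simp [h1, h2]
  filter_upwards [coeFn_simpleMul (f.map k) φ, Lp.coeFn_finsetSum f.range
    (fun y => k y • simpleMul (f.map fun t => if t = y then 1 else 0) φ),
    (Finset.eventually_all f.range).2 h] with x h1 h2 h3
  rw [h1, h2, Finset.sum_apply, Finset.sum_congr rfl h3]
  simp

/-- The power `y ^ z` for `y > 0`, extended by `0`. -/
noncomputable def posPow (z : ℂ) (y : ℝ) : ℂ := if 0 < y then (y : ℂ) ^ z else 0

theorem conj_posPow (z : ℂ) (y : ℝ) : conj (posPow z y) = posPow (conj z) y := by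
  unfold posPow
  split_ifs with h
  · rw [Complex.cpow_conj _ _ (by rw [Complex.arg_ofReal_of_nonneg h.le]; exact Real.pi_pos.ne),
      Complex.conj_ofReal]
  · simp

theorem norm_posPow_of_re_eq_zero {z : ℂ} (hz : z.re = 0) (y : ℝ) : ‖posPow z y‖ ≤ 1 := by
  unfold posPow
  split_ifs with h
  · rw [Complex.norm_cpow_eq_rpow_re_of_pos h, hz, Real.rpow_zero]
  · simp

theorem norm_posPow_of_re_eq_one {z : ℂ} (hz : z.re = 1) {y : ℝ} (hy : 0 ≤ y) :
    ‖posPow z y‖ = y := by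
  unfold posPow
  split_ifs with h
  · rw [Complex.norm_cpow_eq_rpow_re_of_pos h, hz, Real.rpow_one]
  · simp [le_antisymm (not_lt.1 h) hy]

theorem posPow_ofReal {s y : ℝ} (hs : 0 < s) (hy : 0 ≤ y) : posPow (s : ℂ) y = (y ^ s : ℝ) := by
  unfold posPow
  split_ifs with h
  · rw [Complex.ofReal_cpow hy]
  · rw [le_antisymm (not_lt.1 h) hy, Real.zero_rpow hs.ne', Complex.ofReal_zero]

/-- The inner product is antilinear in its first entry, so the exponent there is conjugated to make
the form holomorphic in `z`. Level sets of nonpositive values contribute nothing, which leaves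
positive bases for `norm_sum_cpow_le`. -/
theorem inner_fourier_simpleMul_posPow {n : ℕ} (f g : SimpleFunc (Rn n) ℝ) (φ χ : L2 n) (z : ℂ) :
    ⟪simpleMul (g.map (posPow (conj z))) χ, 𝓕 (simpleMul (f.map (posPow z)) φ)⟫_ℂ =
      ∑ i ∈ (f.range ×ˢ g.range).filter (fun i => 0 < i.1 ∧ 0 < i.2),
        ⟪simpleMul (g.map fun t => if t = i.2 then 1 else 0) χ,
          𝓕 (simpleMul (f.map fun t => if t = i.1 then 1 else 0) φ)⟫_ℂ *
            ((i.1 * i.2 : ℝ) : ℂ) ^ z := by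
  have e : ∀ w : L2 n, 𝓕 w = fourierL2 n w := fun w => rfl
  rw [simpleMul_map f, simpleMul_map g, e, map_sum, sum_inner, Finset.sum_filter,
    Finset.sum_product_right]
  refine Finset.sum_congr rfl fun y' _ => ?_
  rw [inner_sum]
  refine Finset.sum_congr rfl fun y _ => ?_
  rw [map_smul, inner_smul_left, inner_smul_right, conj_posPow, Complex.conj_conj]
  unfold posPow
  by_cases h : 0 < y <;> by_cases h' : 0 < y' <;> simp only [h, h', and_self, and_true, and_false,
    if_true, if_false, zero_mul, mul_zero]
  rw [Complex.ofReal_mul, Complex.mul_cpow_ofReal_nonneg h.le h'.le, e]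
  ring

/-- On the line `Re z = 1` the weight has modulus `f`, so Cauchy–Schwarz applies. -/
theorem integral_norm_simpleMul_le {n : ℕ} {f : SimpleFunc (Rn n) ℝ} (hf : ∀ x, 0 ≤ f x)
    (hf2 : MemLp f 2 volume) (φ : L2 n) {z : ℂ} (hz : z.re = 1) :
    Integrable (simpleMul (f.map (posPow z)) φ) volume ∧
      ∫ x, ‖simpleMul (f.map (posPow z)) φ x‖ ≤ (eLpNorm f 2 volume).toReal * ‖φ‖ := by
  obtain ⟨h1, h2⟩ := integral_norm_smul_le hf2 (Lp.memLp φ)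
  have h3 : ∀ᵐ x, ‖simpleMul (f.map (posPow z)) φ x‖ = ‖f x • φ x‖ := by
    filter_upwards [coeFn_simpleMul (f.map (posPow z)) φ] with x hx
    rw [hx, norm_mul, SimpleFunc.map_apply, norm_posPow_of_re_eq_one hz (hf x), norm_smul,
      Real.norm_of_nonneg (hf x)]
  refine ⟨h1.congr' (Lp.aestronglyMeasurable _) ?_, ?_⟩
  · filter_upwards [h3] with x hx using hx.symm
  · rwa [integral_congr_ae h3]

/-- The interpolated bound for simple functions. -/
theorem norm_inner_fourier_simpleMul_le {n : ℕ} {f g : SimpleFunc (Rn n) ℝ} (hf : ∀ x, 0 ≤ f x)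
    (hg : ∀ x, 0 ≤ g x) (hf2 : MemLp f 2 volume) (hg2 : MemLp g 2 volume) (φ χ : L2 n) {s : ℝ}
    (hs : 0 ≤ s) (hs' : s ≤ 1) :
    ‖⟪simpleMul (g.map (posPow s)) χ, 𝓕 (simpleMul (f.map (posPow s)) φ)⟫_ℂ‖ ≤
      ((eLpNorm f 2 volume).toReal * (eLpNorm g 2 volume).toReal) ^ s * (‖φ‖ * ‖χ‖) := by
  have h := norm_sum_cpow_le ((f.range ×ˢ g.range).filter (fun i => 0 < i.1 ∧ 0 < i.2))
    (fun i => ⟪simpleMul (g.map fun t => if t = i.2 then 1 else 0) χ,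
          𝓕 (simpleMul (f.map fun t => if t = i.1 then 1 else 0) φ)⟫_ℂ)
    (fun i => i.1 * i.2) (A := ‖φ‖ * ‖χ‖)
    (B := ((eLpNorm f 2 volume).toReal * (eLpNorm g 2 volume).toReal) * (‖φ‖ * ‖χ‖))
    (s := s) ?_ ?_ ?_ hs hs'
  · rw [← inner_fourier_simpleMul_posPow f g φ χ, Complex.conj_ofReal] at h
    refine h.trans_eq ?_
    -- With `P = ‖φ‖ ‖χ‖` and `N` the product of the two `L₂` norms, `P^{1-s} (N P)^s = N^s P`, also
    -- when `P = 0`.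
    have hP : 0 ≤ ‖φ‖ * ‖χ‖ := by positivity
    rw [Real.mul_rpow (by positivity) hP, mul_left_comm,
      ← Real.rpow_add_of_nonneg hP (sub_nonneg.2 hs') hs, sub_add_cancel, Real.rpow_one]
  · intro i hi
    exact mul_pos (Finset.mem_filter.1 hi).2.1 (Finset.mem_filter.1 hi).2.2
  · intro z hz
    rw [← inner_fourier_simpleMul_posPow f g φ χ]
    refine (norm_inner_le_norm _ _).trans ?_
    rw [Lp.norm_fourier_eq, mul_comm]
    gcongr
    · exact norm_simpleMul_le _ _ fun x => norm_posPow_of_re_eq_zero hz _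
    · exact norm_simpleMul_le _ _ fun x => norm_posPow_of_re_eq_zero (by simpa using hz) _
  · intro z hz
    rw [← inner_fourier_simpleMul_posPow f g φ χ]
    obtain ⟨h1, h2⟩ := integral_norm_simpleMul_le hf hf2 φ hz
    obtain ⟨h3, h4⟩ := integral_norm_simpleMul_le hg hg2 χ (z := conj z) (by simpa using hz)
    refine (norm_inner_fourier_le_integral_mul _ _ h1 h3).trans ?_
    rw [mul_mul_mul_comm]
    gcongr

/-! ### From simple weights to weights in `L₂`. -/

/-- A nonnegative function is almost everywhere the limit of smaller simple functions. -/
theorem exists_simpleFunc_le_tendsto {X : Type*} [MeasurableSpace X] {μ : Measure X} {f : X → ℝ}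
    (hf : AEStronglyMeasurable f μ) (h0 : ∀ x, 0 ≤ f x) :
    ∃ F : ℕ → SimpleFunc X ℝ, (∀ k x, 0 ≤ F k x) ∧ (∀ᵐ x ∂μ, ∀ k, F k x ≤ f x) ∧
      ∀ᵐ x ∂μ, Tendsto (fun k => F k x) atTop (𝓝 (f x)) := by
  have hm : Measurable fun x => ENNReal.ofReal (hf.mk f x) :=
    hf.stronglyMeasurable_mk.measurable.ennreal_ofReal
  refine ⟨fun k => (SimpleFunc.eapprox (fun x => ENNReal.ofReal (hf.mk f x)) k).map
    ENNReal.toReal, fun k x => by simp, ?_, ?_⟩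
  · filter_upwards [hf.ae_eq_mk] with x hx k
    have h : SimpleFunc.eapprox (fun x => ENNReal.ofReal (hf.mk f x)) k x ≤
        ENNReal.ofReal (hf.mk f x) := by
      rw [← SimpleFunc.iSup_eapprox_apply hm x]
      exact le_iSup (fun k => SimpleFunc.eapprox (fun x => ENNReal.ofReal (hf.mk f x)) k x) k
    have h2 := ENNReal.toReal_mono ENNReal.ofReal_ne_top h
    rw [← hx, ENNReal.toReal_ofReal (h0 x)] at h2
    rwa [SimpleFunc.map_apply]
  · filter_upwards [hf.ae_eq_mk] with x hx
    have h := (ENNReal.tendsto_toReal ENNReal.ofReal_ne_top).comp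
      (SimpleFunc.tendsto_eapprox hm x)
    rw [← hx, ENNReal.toReal_ofReal (h0 x)] at h
    exact h

theorem tendsto_inner_of_dominated {n : ℕ} (w : L2 n) {φ : ℕ → L2 n} {Φ : L2 n}
    (hle : ∀ k, ∀ᵐ x, ‖φ k x‖ ≤ ‖Φ x‖)
    (hlim : ∀ᵐ x, Tendsto (fun k => φ k x) atTop (𝓝 (Φ x))) :
    Tendsto (fun k => ⟪w, φ k⟫_ℂ) atTop (𝓝 ⟪w, Φ⟫_ℂ) := by
  simp only [L2.inner_def]
  refine tendsto_integral_of_dominated_convergence (fun x => ‖w x‖ * ‖Φ x‖)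
    (fun k => (L2.integrable_inner w (φ k)).1)
    (MemLp.integrable_mul (p := 2) (q := 2) (Lp.memLp w).norm (Lp.memLp Φ).norm) ?_ ?_
  · intro k
    filter_upwards [hle k] with x hx
    exact (norm_inner_le_norm _ _).trans (by gcongr)
  · filter_upwards [hlim] with x hx
    exact tendsto_const_nhds.inner hx

/-- Plancherel: taking `𝓕` off `φ` leaves a fixed left entry, so that pointwise dominated
convergence in `φ` can be used. -/
theorem inner_fourier_eq_inner_fourierInv {n : ℕ} (w φ : L2 n) :
    ⟪w, 𝓕 φ⟫_ℂ = ⟪(𝓕⁻ w : L2 n), φ⟫_ℂ := by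
  rw [← Lp.inner_fourier_eq (𝓕⁻ w : L2 n) φ, FourierTransform.fourier_fourierInv_eq]

theorem simpleMul_posPow_le_and_tendsto {n : ℕ} {f : Rn n → ℝ} (h0 : ∀ x, 0 ≤ f x)
    {F : ℕ → SimpleFunc (Rn n) ℝ} (hF0 : ∀ k x, 0 ≤ F k x)
    (hFle : ∀ᵐ x, ∀ k, F k x ≤ f x) (hF : ∀ᵐ x, Tendsto (fun k => F k x) atTop (𝓝 (f x)))
    {s : ℝ} (hs : 0 < s) {φ Φ : L2 n} (hΦ : Φ =ᵐ[volume] fun x => ((f x ^ s : ℝ) : ℂ) * φ x) :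
    (∀ k, ∀ᵐ x, ‖simpleMul ((F k).map (posPow s)) φ x‖ ≤ ‖Φ x‖) ∧
    ∀ᵐ x, Tendsto (fun k => simpleMul ((F k).map (posPow s)) φ x) atTop (𝓝 (Φ x)) := by
  constructor
  · intro k
    filter_upwards [hΦ, hFle, coeFn_simpleMul ((F k).map (posPow s)) φ] with x h1 h2 h3
    rw [h1, h3, SimpleFunc.map_apply, posPow_ofReal hs (hF0 k x), norm_mul, norm_mul,
      Complex.norm_real, Complex.norm_real, Real.norm_of_nonneg (Real.rpow_nonneg (hF0 k x) _),
      Real.norm_of_nonneg (Real.rpow_nonneg (h0 x) _)]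
    gcongr
    · exact hF0 k x
    · exact h2 k
  · filter_upwards [hΦ, hF, ae_all_iff.2 fun k => coeFn_simpleMul ((F k).map (posPow s)) φ]
      with x h1 h2 h3
    simp only [h3, SimpleFunc.map_apply, posPow_ofReal hs (hF0 _ x)]
    rw [h1]
    refine Tendsto.mul_const _ ?_
    exact (Complex.continuous_ofReal.tendsto _).comp (h2.rpow_const (Or.inr hs.le))

theorem memLp_and_eLpNorm_le_of_simpleFunc_le {n : ℕ} {f : Rn n → ℝ} (hf : MemLp f 2 volume)
    {F : SimpleFunc (Rn n) ℝ} (hF0 : ∀ x, 0 ≤ F x) (hFle : ∀ᵐ x, F x ≤ f x) :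
    MemLp F 2 volume ∧ (eLpNorm F 2 volume).toReal ≤ (eLpNorm f 2 volume).toReal := by
  have h : ∀ᵐ x, ‖F x‖ ≤ ‖f x‖ := by
    filter_upwards [hFle] with x hx
    rw [Real.norm_of_nonneg (hF0 x)]
    exact hx.trans (le_abs_self _)
  exact ⟨hf.mono F.aestronglyMeasurable h, ENNReal.toReal_mono hf.2.ne (eLpNorm_mono_ae h)⟩

/-- The Kato-Seiler-Simon bound for the operator norm of `g(ξ)^s 𝓕 f(x)^s`, in bilinear form. -/
theorem norm_inner_fourier_rpow_le {n : ℕ} {f g : Rn n → ℝ} (hf : MemLp f 2 volume)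
    (hg : MemLp g 2 volume) (hf0 : ∀ x, 0 ≤ f x) (hg0 : ∀ x, 0 ≤ g x) {s : ℝ} (hs : 0 < s)
    (hs' : s ≤ 1) {φ χ Φ Ψ : L2 n} (hΦ : Φ =ᵐ[volume] fun x => ((f x ^ s : ℝ) : ℂ) * φ x)
    (hΨ : Ψ =ᵐ[volume] fun x => ((g x ^ s : ℝ) : ℂ) * χ x) :
    ‖⟪Ψ, 𝓕 Φ⟫_ℂ‖ ≤
      ((eLpNorm f 2 volume).toReal * (eLpNorm g 2 volume).toReal) ^ s * (‖φ‖ * ‖χ‖) := by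
  obtain ⟨F, hF0, hFle, hF⟩ := exists_simpleFunc_le_tendsto hf.1 hf0
  obtain ⟨G, hG0, hGle, hG⟩ := exists_simpleFunc_le_tendsto hg.1 hg0
  obtain ⟨h1, h2⟩ := simpleMul_posPow_le_and_tendsto hf0 hF0 hFle hF hs hΦ
  obtain ⟨h3, h4⟩ := simpleMul_posPow_le_and_tendsto hg0 hG0 hGle hG hs hΨ
  rw [norm_inner_symm]
  -- The two weights are approximated one after the other, so each limit concerns a single entry of
  -- the inner product.
  refine le_of_tendsto (tendsto_inner_of_dominated (𝓕 Φ) h3 h4).norm (.of_forall fun j => ?_)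
  rw [norm_inner_symm, inner_fourier_eq_inner_fourierInv]
  refine le_of_tendsto (tendsto_inner_of_dominated _ h1 h2).norm (.of_forall fun k => ?_)
  rw [← inner_fourier_eq_inner_fourierInv]
  obtain ⟨h5, h6⟩ := memLp_and_eLpNorm_le_of_simpleFunc_le hf (hF0 k) (hFle.mono fun x hx => hx k)
  obtain ⟨h7, h8⟩ := memLp_and_eLpNorm_le_of_simpleFunc_le hg (hG0 j) (hGle.mono fun x hx => hx j)
  refine (norm_inner_fourier_simpleMul_le (hF0 k) (hG0 j) h5 h7 φ χ hs.le hs').trans ?_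
  gcongr

/-! ### The Kato–Seiler–Simon bound for complex factors. -/

/-- The product of an element of `L₂` with a bounded function. -/
noncomputable def bddMul {n : ℕ} {G : Rn n → ℂ} (hG : MemLp G ⊤ volume) (u : L2 n) : L2 n :=
  MemLp.toLp (fun x => G x * u x) (MemLp.mul' (p := ⊤) (q := 2) (Lp.memLp u) hG)

theorem coeFn_bddMul {n : ℕ} {G : Rn n → ℂ} (hG : MemLp G ⊤ volume) (u : L2 n) :
    bddMul hG u =ᵐ[volume] fun x => G x * u x :=
  MemLp.coeFn_toLp _

/-- A complex factor is the product of its modulus and of a phase. -/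
theorem exists_norm_mul_eq {n : ℕ} {a : Rn n → ℂ} (ha : AEStronglyMeasurable a volume) (φ : L2 n) :
    ∃ φ' : L2 n, ‖φ'‖ ≤ ‖φ‖ ∧ ∀ᵐ x, a x * φ x = (‖a x‖ : ℂ) * φ' x := by
  have hm : AEStronglyMeasurable (fun x => a x / (‖a x‖ : ℂ)) volume :=
    (ha.aemeasurable.div
      (Complex.measurable_ofReal.comp_aemeasurable ha.norm.aemeasurable)).aestronglyMeasurable
  have hb : ∀ x, ‖a x / (‖a x‖ : ℂ)‖ ≤ 1 := fun x => by
    rw [norm_div, Complex.norm_real, norm_norm]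
    exact div_self_le_one _
  refine ⟨bddMul (memLp_top_of_bound hm 1 (.of_forall hb)) φ, ?_, ?_⟩
  · refine Lp.norm_le_norm_of_ae_le ?_
    filter_upwards [coeFn_bddMul (memLp_top_of_bound hm 1 (.of_forall hb)) φ] with x hx
    rw [hx, norm_mul]
    exact mul_le_of_le_one_left (norm_nonneg _) (hb x)
  · filter_upwards [coeFn_bddMul (memLp_top_of_bound hm 1 (.of_forall hb)) φ] with x hx
    rw [hx]
    by_cases h : a x = 0
    · simp [h]
    · have h' : (‖a x‖ : ℂ) ≠ 0 := by simpa using h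
      field_simp

/-- The Kato-Seiler-Simon bound for the operator norm of `G(ξ) 𝓕 a(x)`. -/
theorem norm_bddMul_fourier_le {n : ℕ} {f g : Rn n → ℝ} (hf : MemLp f 2 volume)
    (hg : MemLp g 2 volume) (hf0 : ∀ x, 0 ≤ f x) (hg0 : ∀ x, 0 ≤ g x) {s : ℝ} (hs : 0 < s)
    (hs' : s ≤ 1) {a G : Rn n → ℂ} (ha : AEStronglyMeasurable a volume)
    (haf : ∀ x, ‖a x‖ = f x ^ s) (hG : MemLp G ⊤ volume) (hGg : ∀ x, G x = (g x ^ s : ℝ))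
    {φ Φ : L2 n} (hΦ : Φ =ᵐ[volume] fun x => a x * φ x) :
    ‖bddMul hG (𝓕 Φ)‖ ≤
      ((eLpNorm f 2 volume).toReal * (eLpNorm g 2 volume).toReal) ^ s * ‖φ‖ := by
  obtain ⟨φ', hφ', h⟩ := exists_norm_mul_eq ha φ
  have h1 : Φ =ᵐ[volume] fun x => ((f x ^ s : ℝ) : ℂ) * φ' x := by
    filter_upwards [hΦ, h] with x h1 h2
    rw [h1, h2, haf]
  set Y := bddMul hG (𝓕 Φ) with hY
  -- Duality: the bilinear bound is tested with `Y = G 𝓕 Φ` itself. As `G` is real, the left side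
  -- becomes `‖Y‖²`.
  have h2 := norm_inner_fourier_rpow_le hf hg hf0 hg0 hs hs' (χ := Y) (Ψ := bddMul hG Y) h1 (by
    filter_upwards [coeFn_bddMul hG Y] with x hx
    rw [hx, hGg])
  have h3 : ⟪bddMul hG Y, 𝓕 Φ⟫_ℂ = ⟪Y, Y⟫_ℂ := by
    rw [L2.inner_def, L2.inner_def]
    refine integral_congr_ae ?_
    filter_upwards [coeFn_bddMul hG Y, coeFn_bddMul hG (𝓕 Φ)] with x h4 h5
    rw [h4]
    nth_rewrite 3 [hY]
    rw [h5, RCLike.inner_apply, RCLike.inner_apply, map_mul, hGg, Complex.conj_ofReal]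
    ring
  rw [h3, inner_self_eq_norm_sq_to_K, norm_pow, RCLike.norm_ofReal, abs_norm, sq,
    ← mul_assoc] at h2
  rcases eq_or_ne ‖Y‖ 0 with h0 | h0
  · rw [h0]; positivity
  · exact (le_of_mul_le_mul_right h2 (lt_of_le_of_ne (norm_nonneg _) h0.symm)).trans (by gcongr)

/-! ### Truncation and Fourier multipliers. -/

/-- The truncation of a complex number at the modulus `N`. -/
noncomputable def truncate (N : ℕ) (z : ℂ) : ℂ := if ‖z‖ ≤ N then z else 0

theorem memLp_top_truncate {n : ℕ} {a : Rn n → ℂ} (ha : AEStronglyMeasurable a volume) (N : ℕ) :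
    MemLp (fun x => truncate N (a x)) ⊤ volume := by
  have hm : Measurable (truncate N) :=
    Measurable.ite (measurableSet_le measurable_norm measurable_const) measurable_id
      measurable_const
  refine memLp_top_of_bound (hm.comp_aemeasurable ha.aemeasurable).aestronglyMeasurable N
    (.of_forall fun x => ?_)
  unfold truncate
  split_ifs with h
  · exact h
  · simp

theorem truncate_eventually_eq (z : ℂ) : ∀ᶠ N : ℕ in atTop, truncate N z = z := by
  filter_upwards [tendsto_natCast_atTop_atTop.eventually_ge_atTop ‖z‖] with N hN
  exact if_pos hN

/-- If the truncations of a multiplier are uniformly bounded at `v`, then `v` is in its domain. -/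
theorem memLp_mul_of_truncate {n : ℕ} {a : Rn n → ℂ} (ha : AEStronglyMeasurable a volume)
    (v : L2 n) {M : ℝ} (hM : ∀ N, ‖bddMul (memLp_top_truncate ha N) v‖ ≤ M) :
    MemLp (fun x => a x * v x) 2 volume ∧
      eLpNorm (fun x => a x * v x) 2 volume ≤ ENNReal.ofReal M := by
  -- Fatou's lemma: at each point the truncations are eventually equal to the full multiplier.
  have h := Lp.eLpNorm_lim_le_liminf_eLpNorm (p := 2) (μ := volume)
    (f := fun N => ⇑(bddMul (memLp_top_truncate ha N) v))
    (fun N => Lp.aestronglyMeasurable _) (fun x => a x * v x) (by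
      filter_upwards [ae_all_iff.2 fun N => coeFn_bddMul (memLp_top_truncate ha N) v] with x hx
      refine tendsto_const_nhds.congr' ?_
      filter_upwards [truncate_eventually_eq (a x)] with N hN
      rw [hx, hN])
  have h2 : eLpNorm (fun x => a x * v x) 2 volume ≤ ENNReal.ofReal M := by
    refine h.trans (liminf_le_of_frequently_le' (.of_forall fun N => ?_))
    rw [← ENNReal.ofReal_toReal (Lp.memLp (bddMul (memLp_top_truncate ha N) v)).2.ne]
    exact ENNReal.ofReal_le_ofReal (hM N)
  exact ⟨⟨ha.mul (Lp.aestronglyMeasurable v), h2.trans_lt ENNReal.ofReal_lt_top⟩, h2⟩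

theorem norm_le_of_norm_sq_le {x C : ℝ} (hx : 0 ≤ x) (hC : 0 ≤ C) (h : x ^ 2 ≤ C * x) : x ≤ C := by
  rcases hx.eq_or_lt with h0 | h0
  · exact h0 ▸ hC
  · exact le_of_mul_le_mul_right (by rwa [sq] at h) h0

theorem conj_truncate_mul (N : ℕ) (z y : ℂ) :
    conj (conj z * (truncate N z * y)) * y = conj (truncate N z * y) * (truncate N z * y) := by
  unfold truncate
  split_ifs with h
  · simp only [map_mul, Complex.conj_conj]; ring
  · simp

/-- The operator of multiplication by `R` in the Fourier variable. -/
noncomputable def fourierMul {n : ℕ} {R : Rn n → ℂ} (hR : MemLp R ⊤ volume) (w : L2 n) : L2 n :=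
  𝓕⁻ (bddMul hR (𝓕 w))

/-- Plancherel turns the form into an integral against `R`; the bound by `|G|²` gives one factor `G`
to each side of Cauchy–Schwarz. -/
theorem norm_inner_fourierMul_le {n : ℕ} {R G : Rn n → ℂ} (hR : MemLp R ⊤ volume)
    (hG : MemLp G ⊤ volume) (hRG : ∀ x, ‖R x‖ ≤ ‖G x‖ ^ 2) (u w : L2 n) :
    ‖⟪u, fourierMul hR w⟫_ℂ‖ ≤ ‖bddMul hG (𝓕 u)‖ * ‖bddMul hG (𝓕 w)‖ := by
  rw [fourierMul, ← Lp.inner_fourier_eq, FourierTransform.fourier_fourierInv_eq]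
  have h1 : Integrable (fun x => ‖bddMul hG (𝓕 u) x‖ • (‖bddMul hG (𝓕 w) x‖ : ℂ)) volume ∧ _ :=
    integral_norm_smul_le (Lp.memLp (bddMul hG (𝓕 u))).norm (Lp.memLp (bddMul hG (𝓕 w))).norm.ofReal
  have h2 : (eLpNorm (fun x => (‖bddMul hG (𝓕 w) x‖ : ℂ)) 2 volume).toReal =
      ‖bddMul hG (𝓕 w)‖ := by
    rw [Lp.norm_def]
    congr 1
    exact eLpNorm_congr_norm_ae (.of_forall fun x => by simp)
  have h3 := h1.2
  rw [eLpNorm_norm, ← Lp.norm_def] at h3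
  refine le_trans ?_ (h3.trans_eq (by rw [← h2]))
  rw [L2.inner_def]
  refine norm_integral_le_of_norm_le h1.1.norm ?_
  filter_upwards [coeFn_bddMul hG (𝓕 u), coeFn_bddMul hG (𝓕 w), coeFn_bddMul hR (𝓕 w)]
    with x h4 h5 h6
  rw [h6, RCLike.inner_apply, norm_mul, norm_mul, RCLike.norm_conj, norm_smul, norm_norm,
    Complex.norm_real, norm_norm, h4, h5, norm_mul, norm_mul]
  calc ‖R x‖ * ‖(𝓕 w : L2 n) x‖ * ‖(𝓕 u : L2 n) x‖
      ≤ ‖G x‖ ^ 2 * ‖(𝓕 w : L2 n) x‖ * ‖(𝓕 u : L2 n) x‖ := by gcongr; exact hRG x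
    _ = _ := by ring

/-- `a R(-i∇)` is bounded if `G(-i∇) conj a` is, where `|R| ≤ |G|²`. -/
theorem memLp_mul_fourierMul {n : ℕ} {a R G : Rn n → ℂ} (ha : AEStronglyMeasurable a volume)
    (hR : MemLp R ⊤ volume) (hG : MemLp G ⊤ volume) (hRG : ∀ x, ‖R x‖ ≤ ‖G x‖ ^ 2) {K : ℝ}
    (hK0 : 0 ≤ K)
    (hK : ∀ φ Φ : L2 n, (Φ =ᵐ[volume] fun x => conj (a x) * φ x) → ‖bddMul hG (𝓕 Φ)‖ ≤ K * ‖φ‖)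
    (w : L2 n) :
    MemLp (fun x => a x * fourierMul hR w x) 2 volume ∧
      eLpNorm (fun x => a x * fourierMul hR w x) 2 volume ≤
        ENNReal.ofReal (K * ‖bddMul hG (𝓕 w)‖) := by
  refine memLp_mul_of_truncate ha _ fun N => ?_
  set v := fourierMul hR w
  -- Self-testing: `⟨ā k, v⟩ = ‖k‖²`, while the form bound gives at most `K ‖k‖ ‖G 𝓕 w‖`. The
  -- truncation makes `‖k‖` finite beforehand, so it can be cancelled.
  set k := bddMul (memLp_top_truncate ha N) v with hk
  have hm : MemLp (fun x => conj (a x) * k x) 2 volume := by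
    have hb : MemLp (fun x => conj (truncate N (a x))) ⊤ volume := (memLp_top_truncate ha N).star
    refine (Lp.memLp (bddMul hb k)).ae_eq ?_
    filter_upwards [coeFn_bddMul hb k, coeFn_bddMul (memLp_top_truncate ha N) v] with x h1 h2
    rw [h1, hk, h2]
    unfold truncate
    split_ifs <;> simp
  have h1 : ⟪hm.toLp _, v⟫_ℂ = ⟪k, k⟫_ℂ := by
    rw [L2.inner_def, L2.inner_def]
    refine integral_congr_ae ?_
    filter_upwards [hm.coeFn_toLp, coeFn_bddMul (memLp_top_truncate ha N) v] with x h1 h2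
    rw [h1, hk, h2, RCLike.inner_apply', RCLike.inner_apply']
    exact conj_truncate_mul N (a x) (v x)
  have h2 := norm_inner_fourierMul_le hR hG hRG (hm.toLp _) w
  rw [h1, inner_self_eq_norm_sq_to_K, norm_pow, RCLike.norm_ofReal, abs_norm] at h2
  refine norm_le_of_norm_sq_le (norm_nonneg _) (by positivity) (h2.trans ?_)
  calc _ ≤ K * ‖k‖ * ‖bddMul hG (𝓕 w)‖ := by
        gcongr
        exact hK k _ hm.coeFn_toLp
    _ = _ := by ring

/-! ### The free resolvent and the Birman–Schwinger principle. -/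

theorem coeFn_mulOp {n : ℕ} {f : Rn n → ℂ} {u : L2 n} (hu : u ∈ mulDomain f) :
    mulOp f ⟨u, hu⟩ =ᵐ[volume] fun x => f x * u x :=
  (mem_mulDomain.1 hu).coeFn_toLp

/-- The action of `(-Δ)^m` in the Fourier variable. -/
theorem exists_freeOp_eq {n : ℕ} {m : ℝ} {u f : L2 n}
    (h : (fun x => symbol m x * (𝓕 u : L2 n) x) =ᵐ[volume] (𝓕 f : L2 n)) :
    ∃ hu : u ∈ (freeOp n m).domain, freeOp n m ⟨u, hu⟩ = f := by
  have h1 : fourierL2 n u ∈ mulDomain (n := n) (symbol m) := (Lp.memLp (𝓕 f : L2 n)).ae_eq h.symm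
  have h2 : mulOp (n := n) (symbol m) ⟨fourierL2 n u, h1⟩ = fourierL2 n f :=
    Lp.ext ((coeFn_mulOp h1).trans h)
  have h3 : fourierInvL2 n (fourierL2 n f) = f :=
    (Lp.fourierTransformₗᵢ (Rn n) ℂ).symm_apply_apply f
  exact ⟨h1, (congrArg (fourierInvL2 n) h2).trans h3⟩

/-- The inverse of `symbol m - z` is the Fourier multiplier of the resolvent of `(-Δ)^m`. -/
theorem fourierMul_mem_freeOp_domain {n : ℕ} {m : ℝ} {z : ℂ} {R : Rn n → ℂ}
    (hR : MemLp R ⊤ volume) (hRz : ∀ x, (symbol m x - z) * R x = 1) (w : L2 n) :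
    ∃ h : fourierMul hR w ∈ (freeOp n m).domain,
      freeOp n m ⟨fourierMul hR w, h⟩ = w + z • fourierMul hR w := by
  have e : 𝓕 (fourierMul hR w) = bddMul hR (𝓕 w) := FourierTransform.fourier_fourierInv_eq _
  have e2 : 𝓕 (w + z • fourierMul hR w) = 𝓕 w + z • bddMul hR (𝓕 w) := by
    rw [FourierTransform.fourier_add, FourierTransform.fourier_smul, e]
  refine exists_freeOp_eq ?_
  rw [e2, e]
  filter_upwards [coeFn_bddMul hR (𝓕 w), Lp.coeFn_add (𝓕 w : L2 n) (z • bddMul hR (𝓕 w)),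
    Lp.coeFn_smul z (bddMul hR (𝓕 w))] with x h2 h3 h4
  rw [h3, Pi.add_apply, h4, Pi.smul_apply, h2, smul_eq_mul]
  linear_combination (𝓕 w : L2 n) x * hRz x

/-- The Birman-Schwinger principle: at an eigenvalue the sandwiched resolvent has norm at least
one. -/
theorem one_le_of_mem_extGraph {n : ℕ} {m : ℝ} {lam : ℂ} {a b R G : Rn n → ℂ}
    (ha : AEStronglyMeasurable a volume) (hb : AEStronglyMeasurable b volume)
    (hR : MemLp R ⊤ volume) (hG : MemLp G ⊤ volume) (hRG : ∀ x, ‖R x‖ ≤ ‖G x‖ ^ 2)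
    (hRz : ∀ x, (symbol m x - conj lam) * R x = 1) {K : ℝ} (hK0 : 0 ≤ K)
    (hKa : ∀ φ Φ : L2 n, (Φ =ᵐ[volume] fun x => a x * φ x) → ‖bddMul hG (𝓕 Φ)‖ ≤ K * ‖φ‖)
    (hKb : ∀ φ Φ : L2 n, (Φ =ᵐ[volume] fun x => conj (b x) * φ x) →
      ‖bddMul hG (𝓕 Φ)‖ ≤ K * ‖φ‖)
    {u : L2 n} (hu0 : u ≠ 0) (hu : (u, lam • u) ∈ extGraph m a b) : 1 ≤ K ^ 2 := by
  obtain ⟨hub, heq⟩ := hu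
  dsimp only at hub heq
  set g := mulOp b ⟨u, hub⟩ with hg
  have hgx : g =ᵐ[volume] fun x => b x * u x := coeFn_mulOp hub
  have key : ∀ w : L2 n, ‖⟪w, u⟫_ℂ‖ ≤ K * ‖bddMul hG (𝓕 w)‖ * ‖g‖ := by
    intro w
    obtain ⟨h1, h2⟩ := memLp_mul_fourierMul (a := fun x => conj (a x)) ha.star hR hG hRG hK0
      (by simpa only [Complex.conj_conj] using hKa) w
    obtain ⟨h3, h4⟩ := fourierMul_mem_freeOp_domain hR hRz w
    -- The test vector is `v = (H₀ - λ̄)⁻¹ w`. Since `H₀ v = w + λ̄ v`, the term `⟨λ̄ v, u⟩` cancels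
    -- `⟨v, λ u⟩`.
    have h5 := heq (fourierMul hR w) h3 h1
    rw [h4, inner_add_left, inner_smul_left, inner_smul_right, Complex.conj_conj] at h5
    have h6 : ⟪w, u⟫_ℂ = -⟪mulOp (fun x => conj (a x)) ⟨fourierMul hR w, h1⟩, g⟫_ℂ := by
      linear_combination h5
    rw [h6, norm_neg]
    refine (norm_inner_le_norm _ _).trans ?_
    gcongr
    refine ENNReal.toReal_le_of_le_ofReal (by positivity) ?_
    rw [eLpNorm_congr_ae (coeFn_mulOp h1)]
    exact h2
  have hg0 : g ≠ 0 := by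
    intro h0
    have := key u
    rw [h0, norm_zero, mul_zero, norm_le_zero_iff] at this
    exact hu0 (inner_self_eq_zero.1 this)
  -- Here `key` is applied to `w = b̄ h`, with `h` the truncation of `b u`: `‖h‖² = ⟨w, u⟩ ≤ K (K
  -- ‖h‖) ‖g‖`.
  have hN : ∀ N, ‖bddMul (memLp_top_truncate hb N) u‖ ≤ K ^ 2 * ‖g‖ := by
    intro N
    set h := bddMul (memLp_top_truncate hb N) u with hh
    have hm : MemLp (fun x => conj (b x) * h x) 2 volume := by
      have hb' : MemLp (fun x => conj (truncate N (b x))) ⊤ volume := (memLp_top_truncate hb N).star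
      refine (Lp.memLp (bddMul hb' h)).ae_eq ?_
      filter_upwards [coeFn_bddMul hb' h, coeFn_bddMul (memLp_top_truncate hb N) u] with x h1 h2
      rw [h1, hh, h2]
      unfold truncate
      split_ifs <;> simp
    have h1 : ⟪hm.toLp _, u⟫_ℂ = ⟪h, h⟫_ℂ := by
      rw [L2.inner_def, L2.inner_def]
      refine integral_congr_ae ?_
      filter_upwards [hm.coeFn_toLp, coeFn_bddMul (memLp_top_truncate hb N) u] with x h1 h2
      rw [h1, hh, h2, RCLike.inner_apply', RCLike.inner_apply']
      exact conj_truncate_mul N (b x) (u x)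
    have h2 := key (hm.toLp _)
    rw [h1, inner_self_eq_norm_sq_to_K, norm_pow, RCLike.norm_ofReal, abs_norm] at h2
    refine norm_le_of_norm_sq_le (norm_nonneg _) (by positivity) (h2.trans ?_)
    calc _ ≤ K * (K * ‖h‖) * ‖g‖ := by
          gcongr
          exact hKb h _ hm.coeFn_toLp
      _ = _ := by ring
  have h7 : ‖g‖ ≤ K ^ 2 * ‖g‖ := by
    have h8 : ‖g‖ = (eLpNorm (fun x => b x * u x) 2 volume).toReal := by
      rw [Lp.norm_def, eLpNorm_congr_ae hgx]
    exact h8.trans_le (ENNReal.toReal_le_of_le_ofReal (by positivity)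
      (memLp_mul_of_truncate hb u hN).2)
  exact le_of_mul_le_mul_right (by rwa [one_mul]) (norm_pos_iff.2 hg0)

/-! ### Integrability and `L_α` norm of the resolvent symbol. -/

/-- A point off the half-line `[0, ∞)` has a positive relative distance from it. -/
theorem exists_mul_one_add_le_norm_sub {z : ℂ} (hz : ∀ r : ℝ, 0 ≤ r → z ≠ r) :
    ∃ c : ℝ, 0 < c ∧ ∀ t : ℝ, 0 ≤ t → c * (1 + t) ≤ ‖(t : ℂ) - z‖ := by
  obtain ⟨d, hd, h⟩ : ∃ d : ℝ, 0 < d ∧ ∀ t : ℝ, 0 ≤ t → d ≤ ‖(t : ℂ) - z‖ := by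
    by_cases him : z.im = 0
    · have hre : z.re < 0 := by
        by_contra h
        exact hz z.re (not_lt.1 h) (Complex.ext (by simp) (by simp [him]))
      refine ⟨-z.re, by linarith, fun t ht => ?_⟩
      have := (le_abs_self _).trans (Complex.abs_re_le_norm ((t : ℂ) - z))
      simp only [Complex.sub_re, Complex.ofReal_re] at this
      linarith
    · refine ⟨|z.im|, abs_pos.2 him, fun t _ => ?_⟩
      simpa using Complex.abs_im_le_norm ((t : ℂ) - z)
  have hpos : 0 < 1 + ‖z‖ + d := by positivity
  -- With `N = ‖t - z‖`, add `(1 + ‖z‖) d ≤ (1 + ‖z‖) N` and `d (t - ‖z‖) ≤ d N`: the left sides sum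
  -- to `d (1 + t)`.
  refine ⟨d / (1 + ‖z‖ + d), by positivity, fun t ht => ?_⟩
  have h1 := h t ht
  have h2 : t - ‖z‖ ≤ ‖(t : ℂ) - z‖ := by
    have := norm_sub_norm_le (t : ℂ) z
    rwa [Complex.norm_real, Real.norm_of_nonneg ht] at this
  rw [div_mul_eq_mul_div, div_le_iff₀ hpos]
  nlinarith [mul_le_mul_of_nonneg_left h1 (by positivity : 0 ≤ 1 + ‖z‖),
    mul_le_mul_of_nonneg_left h2 hd.le]

/-- The symbol of `(-Δ)^m` as a real number. -/
noncomputable def realSymbol {n : ℕ} (m : ℝ) (x : Rn n) : ℝ := (2 * Real.pi * ‖x‖) ^ (2 * m)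

theorem realSymbol_nonneg {n : ℕ} (m : ℝ) (x : Rn n) : 0 ≤ realSymbol m x := by
  unfold realSymbol
  positivity

theorem one_add_norm_rpow_le {n : ℕ} {m : ℝ} (hm : 0 < m) (x : Rn n) :
    (1 + ‖x‖) ^ (2 * m) ≤ 2 ^ (2 * m) * (1 + realSymbol m x) := by
  have h0 : 0 ≤ realSymbol m x := realSymbol_nonneg m x
  have hm2 : 0 ≤ 2 * m := by positivity
  rcases le_total ‖x‖ 1 with h | h
  · calc (1 + ‖x‖) ^ (2 * m) ≤ 2 ^ (2 * m) :=
        Real.rpow_le_rpow (by positivity) (by linarith) hm2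
      _ ≤ _ := le_mul_of_one_le_right (by positivity) (by linarith)
  · have hpi : 1 ≤ 2 * Real.pi := by linarith [Real.two_le_pi]
    have h1 : ‖x‖ ≤ 2 * Real.pi * ‖x‖ := le_mul_of_one_le_left (norm_nonneg x) hpi
    calc (1 + ‖x‖) ^ (2 * m) ≤ (2 * (2 * Real.pi * ‖x‖)) ^ (2 * m) :=
        Real.rpow_le_rpow (by positivity) (by linarith) hm2
      _ = 2 ^ (2 * m) * realSymbol m x := Real.mul_rpow (by norm_num) (by positivity)
      _ ≤ _ := by gcongr; linarith

/-- Off the spectrum `|symbol - z|` dominates a multiple of `(1 + ‖x‖)^{2m}`, and `2mα > n` makes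
the power `-α` integrable. -/
theorem integrable_norm_symbol_sub_rpow {n : ℕ} {m α : ℝ} (hm : 0 < m) (hα : (n : ℝ) < 2 * m * α)
    {z : ℂ} (hz : ∀ r : ℝ, 0 ≤ r → z ≠ r) :
    Integrable (fun x : Rn n => ‖symbol m x - z‖ ^ (-α)) volume := by
  obtain ⟨c, hc, h⟩ := exists_mul_one_add_le_norm_sub hz
  have hα0 : 0 < α := by
    have : 0 < 2 * m * α := lt_of_le_of_lt (Nat.cast_nonneg n) hα
    exact pos_of_mul_pos_right this (by positivity)
  have hi := integrable_one_add_norm (E := Rn n) (μ := volume) (r := 2 * m * α)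
    (by simpa using hα)
  have hs : Measurable (fun x : Rn n => symbol m x) := by
    unfold symbol
    fun_prop
  refine (hi.const_mul ((c / 2 ^ (2 * m)) ^ (-α))).mono'
    ((hs.sub_const z).norm.pow_const _).aestronglyMeasurable (.of_forall fun x => ?_)
  rw [Real.norm_of_nonneg (by positivity)]
  have h1 : c / 2 ^ (2 * m) * (1 + ‖x‖) ^ (2 * m) ≤ ‖symbol m x - z‖ := by
    refine le_trans ?_ (h _ (realSymbol_nonneg m x))
    rw [div_mul_eq_mul_div, div_le_iff₀ (by positivity), mul_assoc]
    gcongr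
    exact (one_add_norm_rpow_le hm x).trans_eq (mul_comm _ _)
  calc ‖symbol m x - z‖ ^ (-α) ≤ (c / 2 ^ (2 * m) * (1 + ‖x‖) ^ (2 * m)) ^ (-α) :=
        Real.rpow_le_rpow_of_nonpos (by positivity) h1 (by linarith)
    _ = _ := by
        rw [Real.mul_rpow (by positivity) (by positivity), ← Real.rpow_mul (by positivity),
          mul_neg]

/-- The law of cosines. -/
theorem norm_mul_sub_conj (z : ℂ) {t : ℝ} :
    ‖((‖z‖ * t : ℝ) : ℂ) - conj z‖ =
      ‖z‖ * (t ^ 2 - 2 * t * Real.cos (Complex.arg z) + 1) ^ (1 / 2 : ℝ) := by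
  have hre : ‖z‖ * Real.cos (Complex.arg z) = z.re := Complex.norm_mul_cos_arg z
  have him : ‖z‖ * Real.sin (Complex.arg z) = z.im := Complex.norm_mul_sin_arg z
  have hsc := Real.sin_sq_add_cos_sq (Complex.arg z)
  rw [← Real.sqrt_eq_rpow]
  nth_rewrite 2 [← Real.sqrt_sq (norm_nonneg z)]
  rw [← Real.sqrt_mul (sq_nonneg _),
    Complex.norm_eq_sqrt_sq_add_sq (((‖z‖ * t : ℝ) : ℂ) - conj z)]
  congr 1
  simp only [Complex.sub_re, Complex.sub_im, Complex.ofReal_re, Complex.ofReal_im, Complex.conj_re,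
    Complex.conj_im]
  rw [← hre, ← him]
  linear_combination ‖z‖ ^ 2 * hsc

/-- The radial integral of a function of the symbol. -/
theorem integral_comp_realSymbol {n : ℕ} (hn : 1 ≤ n) {m : ℝ} (hm : 0 < m) {l : ℝ} (hl : 0 < l)
    (F : ℝ → ℝ) :
    ∫ x : Rn n, F (realSymbol m x) =
      (4 * Real.pi) ^ (-((n : ℝ) / 2)) * (m * Real.Gamma ((n : ℝ) / 2))⁻¹ *
        l ^ ((n : ℝ) / (2 * m)) *
        ∫ t in Set.Ioi (0 : ℝ), t ^ ((n : ℝ) / (2 * m) - 1) * F (l * t) := by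
  have : Nonempty (Fin n) := ⟨⟨0, hn⟩⟩
  have hn0 : (0 : ℝ) < n := by exact_mod_cast hn
  have hpi := Real.pi_pos
  set p : ℝ := 1 / (2 * m) with hp
  have hp0 : 0 < p := by positivity
  set c : ℝ := l / (2 * Real.pi) ^ (2 * m) with hc
  have hc0 : 0 < c := by positivity
  have h1 := integral_fun_norm_addHaar (volume : Measure (Rn n))
    (fun r => F ((2 * Real.pi * r) ^ (2 * m)))
  -- Substitution `y = x^{1/(2m)}`, after which the symbol is linear in the variable.
  have h2 : ∫ y in Set.Ioi (0 : ℝ), y ^ (n - 1) • F ((2 * Real.pi * y) ^ (2 * m)) =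
      p * ∫ x in Set.Ioi (0 : ℝ), x ^ ((n : ℝ) / (2 * m) - 1) * F ((2 * Real.pi) ^ (2 * m) * x) := by
    rw [← integral_comp_rpow_Ioi_of_pos hp0, ← integral_const_mul]
    refine setIntegral_congr_fun measurableSet_Ioi fun x hx => ?_
    have hx0 : (0 : ℝ) < x := hx
    have e1 : (2 * Real.pi * x ^ p) ^ (2 * m) = (2 * Real.pi) ^ (2 * m) * x := by
      rw [Real.mul_rpow (by positivity) (by positivity), ← Real.rpow_mul hx0.le, hp,
        one_div_mul_cancel (by positivity), Real.rpow_one]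
    have e2 : x ^ (p - 1) * (x ^ p) ^ (n - 1) = x ^ ((n : ℝ) / (2 * m) - 1) := by
      rw [← Real.rpow_natCast, ← Real.rpow_mul hx0.le, ← Real.rpow_add hx0, Nat.cast_sub hn, hp]
      congr 1
      push_cast
      ring
    simp only [smul_eq_mul]
    rw [e1, ← e2]
    ring
  -- Scaling `x = c t`, with `c` chosen so that the symbol becomes `l t`.
  have h3 : ∫ x in Set.Ioi (0 : ℝ), x ^ ((n : ℝ) / (2 * m) - 1) * F ((2 * Real.pi) ^ (2 * m) * x) =
      c ^ ((n : ℝ) / (2 * m)) *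
        ∫ t in Set.Ioi (0 : ℝ), t ^ ((n : ℝ) / (2 * m) - 1) * F (l * t) := by
    have := integral_comp_mul_left_Ioi'
      (fun x => x ^ ((n : ℝ) / (2 * m) - 1) * F ((2 * Real.pi) ^ (2 * m) * x)) 0 hc0
    rw [mul_zero] at this
    rw [← this, smul_eq_mul, ← integral_const_mul, ← integral_const_mul]
    refine setIntegral_congr_fun measurableSet_Ioi fun t ht => ?_
    have ht0 : (0 : ℝ) < t := ht
    have e1 : (2 * Real.pi) ^ (2 * m) * (c * t) = l * t := by
      rw [hc]
      field_simp
    have e2 : c * c ^ ((n : ℝ) / (2 * m) - 1) = c ^ ((n : ℝ) / (2 * m)) := by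
      rw [Real.rpow_sub_one hc0.ne']
      field_simp
    rw [e1, Real.mul_rpow hc0.le ht0.le, ← e2]
    ring
  have h4 : (volume : Measure (Rn n)).real (Metric.ball 0 1) =
      Real.pi ^ ((n : ℝ) / 2) / ((n : ℝ) / 2 * Real.Gamma ((n : ℝ) / 2)) := by
    rw [Measure.real, EuclideanSpace.volume_ball, ENNReal.ofReal_one, one_pow, one_mul,
      ENNReal.toReal_ofReal (by positivity), Fintype.card_fin, Real.Gamma_add_one (by positivity),
      Real.sqrt_eq_rpow, ← Real.rpow_natCast, ← Real.rpow_mul hpi.le]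
    congr 2
    ring
  have h5 : c ^ ((n : ℝ) / (2 * m)) = l ^ ((n : ℝ) / (2 * m)) / (2 * Real.pi) ^ (n : ℝ) := by
    rw [hc, Real.div_rpow hl.le (by positivity), ← Real.rpow_mul (by positivity)]
    congr 2
    field_simp
  have h6 : (4 * Real.pi) ^ (-((n : ℝ) / 2)) = Real.pi ^ ((n : ℝ) / 2) / (2 * Real.pi) ^ (n : ℝ) := by
    have e : (2 * Real.pi) ^ (n : ℝ) = (4 * Real.pi) ^ ((n : ℝ) / 2) * Real.pi ^ ((n : ℝ) / 2) := by
      rw [← Real.mul_rpow (by positivity) hpi.le,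
        show 4 * Real.pi * Real.pi = (2 * Real.pi) ^ (2 : ℝ) by rw [Real.rpow_two]; ring,
        ← Real.rpow_mul (by positivity)]
      congr 1
      ring
    rw [Real.rpow_neg (by positivity), e]
    field_simp
  have hG : 0 < Real.Gamma ((n : ℝ) / 2) := Real.Gamma_pos_of_pos (by positivity)
  change ∫ x : Rn n, F ((2 * Real.pi * ‖x‖) ^ (2 * m)) = _
  rw [h1, finrank_euclideanSpace_fin, h2, h3, h4, h5, h6, nsmul_eq_mul, smul_eq_mul, hp]
  field_simp

/-- The `L_α` norm of the symbol of the resolvent. -/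
theorem integral_norm_symbol_sub_rpow {n : ℕ} (hn : 1 ≤ n) {m γ : ℝ} (hm : 0 < m) {lam : ℂ}
    (hlam : lam ≠ 0) :
    ∫ x : Rn n, ‖symbol m x - conj lam‖ ^ (-(γ + (n : ℝ) / (2 * m))) =
      ‖lam‖ ^ (-γ) * constC n m (γ + (n : ℝ) / (2 * m)) (Complex.arg lam) := by
  set α := γ + (n : ℝ) / (2 * m) with hα
  have hl : 0 < ‖lam‖ := norm_pos_iff.2 hlam
  have h := integral_comp_realSymbol hn hm hl (fun σ => ‖(σ : ℂ) - conj lam‖ ^ (-α))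
  have h2 : ∫ t in Set.Ioi (0 : ℝ), t ^ ((n : ℝ) / (2 * m) - 1) *
      ‖((‖lam‖ * t : ℝ) : ℂ) - conj lam‖ ^ (-α) = ‖lam‖ ^ (-α) * constI n m α (Complex.arg lam) := by
    rw [constI, ← integral_const_mul]
    refine setIntegral_congr_fun measurableSet_Ioi fun t _ => ?_
    have hq : 0 ≤ t ^ 2 - 2 * t * Real.cos (Complex.arg lam) + 1 := by
      nlinarith [sq_nonneg (t - Real.cos (Complex.arg lam)),
        Real.cos_sq_le_one (Complex.arg lam)]
    rw [norm_mul_sub_conj, Real.mul_rpow hl.le (by positivity), ← Real.rpow_mul hq,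
      show 1 / 2 * -α = -(α / 2) by ring, Real.rpow_neg hq]
    ring
  rw [h2] at h
  refine h.trans ?_
  have h3 : ‖lam‖ ^ (-γ) = ‖lam‖ ^ ((n : ℝ) / (2 * m)) * ‖lam‖ ^ (-α) := by
    rw [← Real.rpow_add hl, hα]
    congr 1
    ring
  rw [h3, constC]
  ring

/-! ### `L_α` norms as `L₂` norms, and the two factors of `q`. -/

theorem sq_eLpNorm_two_toReal {X : Type*} [MeasurableSpace X] {μ : Measure X} {f : X → ℝ}
    (hf : MemLp f 2 μ) : (eLpNorm f 2 μ).toReal ^ 2 = ∫ x, f x ^ 2 ∂μ := by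
  rw [hf.eLpNorm_eq_integral_rpow_norm (by norm_num) (by norm_num),
    ENNReal.toReal_ofReal (by positivity), ENNReal.toReal_ofNat, ← Real.rpow_natCast,
    ← Real.rpow_mul (integral_nonneg fun x => by positivity)]
  norm_num

/-- Passing to the power `α/2` turns `L_α` data into the `L₂` weights required by the interpolated
bound. -/
theorem memLp_two_rpow_half {X : Type*} [MeasurableSpace X] {μ : Measure X} {h : X → ℝ}
    (h0 : ∀ x, 0 ≤ h x) {α : ℝ} (hm : AEStronglyMeasurable h μ)
    (hi : Integrable (fun x => h x ^ α) μ) :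
    MemLp (fun x => h x ^ (α / 2)) 2 μ ∧
      (eLpNorm (fun x => h x ^ (α / 2)) 2 μ).toReal ^ 2 = ∫ x, h x ^ α ∂μ := by
  have e : ∀ x, (h x ^ (α / 2)) ^ 2 = h x ^ α := fun x => by
    rw [← Real.rpow_natCast, ← Real.rpow_mul (h0 x)]
    congr 1
    push_cast
    ring
  have hl : MemLp (fun x => h x ^ (α / 2)) 2 μ :=
    (memLp_two_iff_integrable_sq (hm.aemeasurable.pow_const _).aestronglyMeasurable).2
      (by simpa only [e] using hi)
  exact ⟨hl, by simpa only [e] using sq_eLpNorm_two_toReal hl⟩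

theorem aestronglyMeasurable_factorA {n : ℕ} {q : Rn n → ℂ} (hq : AEStronglyMeasurable q volume) :
    AEStronglyMeasurable (factorA q) volume :=
  (Complex.measurable_ofReal.comp_aemeasurable
    (Real.continuous_sqrt.measurable.comp_aemeasurable hq.norm.aemeasurable)).aestronglyMeasurable

theorem aestronglyMeasurable_factorB {n : ℕ} {q : Rn n → ℂ} (hq : AEStronglyMeasurable q volume) :
    AEStronglyMeasurable (factorB q) volume :=
  ((hq.aemeasurable.div (Complex.measurable_ofReal.comp_aemeasurable
    hq.norm.aemeasurable)).aestronglyMeasurable).mul (aestronglyMeasurable_factorA hq)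

theorem norm_factorA {n : ℕ} (q : Rn n → ℂ) (x : Rn n) :
    ‖factorA q x‖ = ‖q x‖ ^ (1 / 2 : ℝ) := by
  rw [factorA, Complex.norm_real, Real.norm_of_nonneg (Real.sqrt_nonneg _), Real.sqrt_eq_rpow]

theorem norm_factorB {n : ℕ} (q : Rn n → ℂ) (x : Rn n) :
    ‖factorB q x‖ = ‖q x‖ ^ (1 / 2 : ℝ) := by
  rw [← norm_factorA]
  change ‖q x / (‖q x‖ : ℂ) * factorA q x‖ = _
  rw [norm_mul, norm_div, Complex.norm_real, norm_norm]
  rcases eq_or_ne (q x) 0 with h | h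
  · simp [factorA, h]
  · rw [div_self (norm_ne_zero_iff.2 h), one_mul]

/-! ### The eigenvalue estimate. -/

/-- An eigenvalue of `H_{m,q}` is a pair in the defining graph. -/
theorem exists_mem_extGraph_of_isEigenvalue {n : ℕ} {m : ℝ} (hm : 0 < m) {q : Rn n → ℂ}
    {p : ENNReal} (hp : 1 ≤ p) (hq : MemLp q p volume) {lam : ℂ}
    (h : IsEigenvalue (polyOp m q) lam) :
    ∃ u : L2 n, u ≠ 0 ∧ (u, lam • u) ∈ extGraph m (factorA q) (factorB q) := by
  obtain ⟨u, hu, he⟩ := h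
  refine ⟨u, hu, ?_⟩
  rw [← polyOp_graph hm hp hq, ← he]
  exact LinearPMap.mem_graph _ u

/-- The bound `1 ≤ ‖q‖_α^α ‖(|2πξ|^{2m} - λ)⁻¹‖_α^α` at an eigenvalue. -/
theorem one_le_integral_mul_integral {n : ℕ} {m α : ℝ} (hm : 0 < m) (hα1 : 1 ≤ α)
    (hα : (n : ℝ) < 2 * m * α) {q : Rn n → ℂ} (hq : MemLp q (ENNReal.ofReal α) volume) {lam : ℂ}
    (hlam : ∀ r : ℝ, 0 ≤ r → lam ≠ r) (heig : IsEigenvalue (polyOp m q) lam) :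
    1 ≤ (∫ x, ‖q x‖ ^ α) * ∫ x : Rn n, ‖symbol m x - conj lam‖ ^ (-α) := by
  have hα0 : 0 < α := by linarith
  have hz : ∀ r : ℝ, 0 ≤ r → conj lam ≠ r := fun r hr h => hlam r hr (by
    rw [← Complex.conj_conj lam, h, Complex.conj_ofReal])
  obtain ⟨u, hu0, hu⟩ := exists_mem_extGraph_of_isEigenvalue hm (by simpa using hα1) hq heig
  obtain ⟨c, hc, hlow⟩ := exists_mul_one_add_le_norm_sub hz
  have hlow' : ∀ x : Rn n, c ≤ ‖symbol m x - conj lam‖ := fun x =>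
    (le_mul_of_one_le_right hc.le (le_add_of_nonneg_right (realSymbol_nonneg m x))).trans
      (hlow _ (realSymbol_nonneg m x))
  have hs : Measurable (fun x : Rn n => symbol m x - conj lam) := by
    unfold symbol
    fun_prop
  set ρ : Rn n → ℝ := fun x => ‖symbol m x - conj lam‖⁻¹ with hρ
  have hρ0 : ∀ x, 0 ≤ ρ x := fun x => by positivity
  have hρc : ∀ x, ρ x ≤ c⁻¹ := fun x => inv_anti₀ hc (hlow' x)
  have hρm : Measurable ρ := hs.norm.inv
  have hρe : ∀ x, ρ x ^ α = ‖symbol m x - conj lam‖ ^ (-α) := fun x => by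
    rw [hρ, Real.inv_rpow (norm_nonneg _), Real.rpow_neg (norm_nonneg _)]
  -- The weights are `|q|^{α/2}` and `ρ^{α/2}` with `s = 1/α`, so their powers `s` are `|q|^{1/2}`
  -- and `ρ^{1/2}`. The condition `s ≤ 1` is `1 ≤ α`.
  obtain ⟨hf, hf2⟩ := memLp_two_rpow_half (h := fun x => ‖q x‖) (α := α)
    (fun x => norm_nonneg _) hq.1.norm (by
      have := hq.integrable_norm_rpow (by simpa using hα0) ENNReal.ofReal_ne_top
      rwa [ENNReal.toReal_ofReal hα0.le] at this)
  obtain ⟨hg, hg2⟩ := memLp_two_rpow_half hρ0 (α := α) hρm.aestronglyMeasurable (by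
    simpa only [hρe] using integrable_norm_symbol_sub_rpow hm hα hz)
  simp only [hρe] at hg2
  have hpow : ∀ t : ℝ, 0 ≤ t → (t ^ (α / 2)) ^ (1 / α) = t ^ (1 / 2 : ℝ) := fun t ht => by
    rw [← Real.rpow_mul ht]
    congr 1
    field_simp
  have hR : MemLp (fun x : Rn n => (symbol m x - conj lam)⁻¹) ⊤ volume :=
    memLp_top_of_bound hs.inv.aestronglyMeasurable c⁻¹ (.of_forall fun x => by
      rw [norm_inv]
      exact hρc x)
  have hG : MemLp (fun x : Rn n => ((((ρ x) ^ (α / 2)) ^ (1 / α) : ℝ) : ℂ)) ⊤ volume := by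
    refine memLp_top_of_bound (Complex.measurable_ofReal.comp
      ((hρm.pow_const _).pow_const _)).aestronglyMeasurable ((c⁻¹) ^ (1 / 2 : ℝ))
      (.of_forall fun x => ?_)
    rw [hpow _ (hρ0 x), Complex.norm_real, Real.norm_of_nonneg (by positivity)]
    exact Real.rpow_le_rpow (hρ0 x) (hρc x) (by norm_num)
  have hK := one_le_of_mem_extGraph (aestronglyMeasurable_factorA hq.1)
    (aestronglyMeasurable_factorB hq.1) hR hG (fun x => by
      rw [hpow _ (hρ0 x), Complex.norm_real, Real.norm_of_nonneg (by positivity),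
        ← Real.rpow_natCast, ← Real.rpow_mul (hρ0 x), norm_inv]
      norm_num [hρ])
    (fun x => mul_inv_cancel₀ (norm_pos_iff.1 (hc.trans_le (hlow' x)))) (by positivity)
    (fun φ Φ h => norm_bddMul_fourier_le hf hg (fun x => by positivity) (fun x => by positivity)
      (by positivity) (by rw [div_le_one hα0]; exact hα1) (aestronglyMeasurable_factorA hq.1)
      (fun x => by rw [norm_factorA, hpow _ (norm_nonneg _)]) hG (fun x => rfl) h)
    (fun φ Φ h => norm_bddMul_fourier_le hf hg (fun x => by positivity) (fun x => by positivity)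
      (by positivity) (by rw [div_le_one hα0]; exact hα1) (aestronglyMeasurable_factorB hq.1).star
      (fun x => by rw [Pi.star_apply, norm_star, norm_factorB, hpow _ (norm_nonneg _)]) hG
      (fun x => rfl) h)
    hu0 hu
  -- The product of integrals is the square of the product of `L₂` norms. Were that product below
  -- `1`, so would be its power `1/α`, contradicting `1 ≤ K²`.
  rw [← hf2, ← hg2, ← mul_pow]
  refine one_le_pow₀ ?_
  by_contra hlt
  have h1 := Real.rpow_lt_one (by positivity) (not_le.1 hlt) (by positivity : 0 < 1 / α)
  have h2 := pow_lt_one₀ (Real.rpow_nonneg (by positivity) _) h1 two_ne_zero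
  exact absurd hK (not_le.2 h2)

end Polyharmonic

theorem mainTheorem11 (n : ℕ) (hn : 1 ≤ n) (m γ : ℝ) (hm : 0 < m)
    (hγ : 2 * m ≤ (n : ℝ) → 0 < γ) (hγ' : (n : ℝ) < 2 * m → 1 - (n : ℝ) / (2 * m) ≤ γ)
    (q : Polyharmonic.Rn n → ℂ)
    (hq : MemLp q (ENNReal.ofReal (γ + (n : ℝ) / (2 * m))) volume)
    (lam : ℂ) (hlam : ∀ r : ℝ, 0 ≤ r → lam ≠ (r : ℂ))
    (heig : Polyharmonic.IsEigenvalue (Polyharmonic.polyOp m q) lam) :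
    ‖lam‖ ^ γ ≤
      Polyharmonic.constC n m (γ + (n : ℝ) / (2 * m)) (Complex.arg lam) *
        ∫ x : Polyharmonic.Rn n, ‖q x‖ ^ (γ + (n : ℝ) / (2 * m)) := by
  have h2m : 0 < 2 * m := by positivity
  have hlam0 : lam ≠ 0 := by simpa using hlam 0 le_rfl
  have hl : 0 < ‖lam‖ := norm_pos_iff.2 hlam0
  -- Both regimes give the two facts needed: `γ > 0`, equivalent to the integrability condition `2mα
  -- > n`, and `α ≥ 1`, for the interpolation.
  have hγα : 0 < γ ∧ 1 ≤ γ + (n : ℝ) / (2 * m) := by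
    rcases le_or_gt (2 * m) (n : ℝ) with h | h
    · exact ⟨hγ h, by linarith [hγ h, (one_le_div h2m).2 h]⟩
    · exact ⟨by linarith [hγ' h, (div_lt_one h2m).2 h], by linarith [hγ' h]⟩
  have hα : (n : ℝ) < 2 * m * (γ + (n : ℝ) / (2 * m)) := by
    rw [mul_add, mul_div_cancel₀ _ h2m.ne']
    linarith [mul_pos h2m hγα.1]
  have key := Polyharmonic.one_le_integral_mul_integral hm hγα.2 hα hq hlam heig
  rw [Polyharmonic.integral_norm_symbol_sub_rpow hn hm hlam0, Real.rpow_neg hl.le] at key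
  have h := mul_le_mul_of_nonneg_left key (Real.rpow_nonneg hl.le γ)
  rw [mul_one] at h
  refine h.trans_eq ?_
  have h0 : ‖lam‖ ^ γ ≠ 0 := (Real.rpow_pos_of_pos hl γ).ne'
  field_simp
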